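/- Let $\mathcal{P}$ be a real affine plane (a principal homogeneous space under a real vector space of dimension $2$, with its usual topology) and let $\pi:\mathcal{P}\to\mathbb{R}$ be a non-constant affine function; the fibres of $\pi$ are called vertical lines. Let $\mathcal{D}\subseteq\mathcal{P}$ be an algebraic domain, that is, a non-empty closed subset which is homeomorphic to a surface with (possibly empty) boundary, and whose boundary $\mathcal{C}=\partial\mathcal{D}$ is a disjoint union of finitely many smooth connected components of real algebraic curves (each one is a connected component of the zero locus of a real polynomial in two variables whose gradient does not vanish at any point of this component). Then the following conditions are equivalent: 1. $\mathcal{D}$ is a domain of finite type: $\mathcal{D}$ is a closed subset homeomorphic to a surface with non-empty boundary, the restriction $\pi|_{\mathcal{D}}:\mathcal{D}\to\mathbb{R}$ is proper, and the topological critical set of $\mathcal{C}$ is finite. Here the topological critical set consists of the points of $\mathcal{C}$ none of whose neighbourhoods in $\mathcal{C}$ is mapped by $\pi$ homeomorphically onto its image. 2. The restriction $\pi|_{\mathcal{D}}:\mathcal{D}\to\mathbb{R}$ is proper. 3. At least one fibre of $\pi|_{\mathcal{D}}:\mathcal{D}\to\mathbb{R}$ is compact, and $\mathcal{C}$ contains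 no vertical line and has no vertical asymptote. Here $\mathcal{C}$ has a vertical asymptote if there are $t\in\mathbb{R}$ and a continuous injective map $\gamma:[0,\infty)\to\mathcal{C}$ such that $\gamma(s)$ leaves every compact subset of $\mathcal{P}$ and $\pi(\gamma(s))\to t$ as $s\to\infty$. -/

import Mathlib

open Topology Filter

namespace AlgDomain

section Topological

variable {P : Type*} [TopologicalSpace P]

/-- The topological critical set of the projection `π` restricted to `C`: the points of `C` none of
whose neighbourhoods in `C` is mapped by `π` homeomorphically onto its image. -/
def topCriticalSet (π : P → ℝ) (C : Set P) : Set P :=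
  {p | p ∈ C ∧ ¬ ∃ U : Set P, IsOpen U ∧ p ∈ U ∧ IsEmbedding ((U ∩ C).domRestrict π)}

/-- `D`, with the subspace topology, is a topological surface with (possibly empty) boundary:
every point has a neighbourhood homeomorphic to an open subset of the closed half-plane. -/
def IsSurfaceWithBoundary (D : Set P) : Prop :=
  Nonempty (ChartedSpace (EuclideanHalfSpace 2) D)

/-- Domains of finite type relative to the projection `π` of a vertical plane `P`. The boundary of
a closed subsurface `D` of the plane is its frontier. -/
structure IsDomainOfFiniteType (π : P → ℝ) (D : Set P) : Prop where
  isClosed : IsClosed D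
  isSurface : IsSurfaceWithBoundary D
  boundary_nonempty : (frontier D).Nonempty
  isProper : IsProperMap (D.domRestrict π)
  finite_critical : (topCriticalSet π (frontier D)).Finite

/-- `C` contains a whole vertical line, that is, a fibre of `π`. -/
def ContainsVerticalLine (π : P → ℝ) (C : Set P) : Prop :=
  ∃ t : ℝ, π ⁻¹' {t} ⊆ C

/-- Some vertical line `π = t` is an asymptote of `C`: an arc of `C`, parametrized by `[0, ∞)`,
goes to infinity in the plane while approaching this line. -/
def HasVerticalAsymptote (π : P → ℝ) (C : Set P) : Prop :=
  ∃ (t : ℝ) (γ : NNReal → P), Continuous γ ∧ Function.Injective γ ∧ (∀ s, γ s ∈ C) ∧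
    Tendsto γ atTop (cocompact P) ∧ Tendsto (fun s => π (γ s)) atTop (𝓝 t)

end Topological

section Affine

variable {V P : Type*} [AddCommGroup V] [Module ℝ V] [AddTorsor V P] [TopologicalSpace P]

/-- `K` is a smooth connected component of a real algebraic curve of the affine plane `P`: in some
affine coordinates `e` it is a connected component of the zero locus of a polynomial `F`, and the
gradient of `F` vanishes nowhere on `K` (in particular, `F` is not constant). -/
def IsSmoothCurveComponent (K : Set P) : Prop :=
  ∃ (e : P ≃ᵃ[ℝ] (Fin 2 → ℝ)) (F : MvPolynomial (Fin 2) ℝ),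
    (∃ p : P, MvPolynomial.eval (e p) F = 0 ∧
      K = connectedComponentIn {q : P | MvPolynomial.eval (e q) F = 0} p) ∧
    ∀ p ∈ K, ∃ i : Fin 2, MvPolynomial.eval (e p) (MvPolynomial.pderiv i F) ≠ 0

/-- Algebraic domains of an affine plane `P`: closed subsurfaces whose boundary is a disjoint
union of finitely many smooth connected components of real algebraic curves. -/
structure IsAlgebraicDomain (D : Set P) : Prop where
  isClosed : IsClosed D
  isSurface : IsSurfaceWithBoundary D
  boundary_algebraic : ∃ 𝒦 : Set (Set P), 𝒦.Finite ∧ 𝒦.PairwiseDisjoint id ∧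
    (∀ K ∈ 𝒦, IsSmoothCurveComponent K) ∧ frontier D = ⋃₀ 𝒦

end Affine

end AlgDomain

/-! In affine coordinates `(x, y)` with `π = x`, properness of `π` on the closed set `D` means that
`y` is bounded on the part of `D` over each compact interval (`isProperMap_domRestrict_iff`). This
at once excludes vertical lines and vertical asymptotes.

For 3 ⇒ 2, each boundary component `K` lies in a curve `G = 0`. Over all but finitely many
abscissae, `K` has no vertical tangent (`finite_verticalTangencies`) and stays locally bounded (the
leading coefficient of `G` in `y` does not vanish). If `K` were unbounded beside the line `x = t`,
say upwards on the right, its topmost point would be a continuous function `g` on some `(t, u)`.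
Either `g → ∞` at `t`, and its graph is a vertical asymptote, or by the intermediate value theorem
`g` takes every large value `c` arbitrarily near `t`, so that `(t, c) ∈ K` for infinitely many `c`,
although the fibres of `K` are finite. Hence the boundary is bounded over compact intervals. The
half-strips beyond this bound are connected and miss the boundary, so each lies inside or outside
`D`; the compact fibre forces them outside (`bounded_of_bounded_frontier`).

For 2 ⇒ 1, critical points satisfy `∂G/∂y = 0`; they have finitely many abscissae and lie in finite
fibres. The boundary is non-empty because properness forbids `D = P`. -/

namespace AlgDomain

open Polynomial
open scoped Polynomial.Bivariate

/-! ### Finiteness of vertical tangencies -/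

section Algebra

variable {K : Type*} [Field K]

/-- The abscissae of the smooth points with vertical tangent of the affine curve `F = 0` that do
not lie on a vertical line contained in the curve. -/
def verticalTangencies (F : K[X][Y]) : Set K :=
  {x | ∃ y, F.evalEval x y = 0 ∧ (derivative F).evalEval x y = 0 ∧
    (derivative (F.eval (C y))).eval x ≠ 0 ∧ F.map (evalRingHom x) ≠ 0}

/-- Where one factor vanishes, both partial derivatives of the product are those of that factor
times the other factor. The non-zero `x`-derivative shows that this other factor is non-zero, so it
cancels. -/
theorem verticalTangencies_mul_subset (F G : K[X][Y]) :
    verticalTangencies (F * G) ⊆ verticalTangencies F ∪ verticalTangencies G := by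
  rintro x ⟨y, h0, hy, hx, hm⟩
  rw [evalEval_mul] at h0
  rw [derivative_mul, evalEval_add, evalEval_mul, evalEval_mul] at hy
  rw [eval_mul, derivative_mul, eval_add, eval_mul, eval_mul] at hx
  rw [Polynomial.map_mul] at hm
  change _ * G.evalEval x y + F.evalEval x y * _ ≠ 0 at hx
  rcases mul_eq_zero.1 h0 with h | h
  · rw [h, zero_mul, add_zero] at hx hy
    exact Or.inl ⟨y, h, (mul_eq_zero.1 hy).resolve_right (right_ne_zero_of_mul hx),
      left_ne_zero_of_mul hx, left_ne_zero_of_mul hm⟩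
  · rw [h, mul_zero, zero_add] at hx hy
    exact Or.inr ⟨y, h, (mul_eq_zero.1 hy).resolve_left (left_ne_zero_of_mul hx),
      right_ne_zero_of_mul hx, right_ne_zero_of_mul hm⟩

/-- By Gauss's lemma `H` stays irreducible over `K(X)`, hence is separable in characteristic zero;
clearing denominators in a Bézout relation gives `r`. Common zeros of `H` and `∂H/∂Y` therefore lie
over the roots of `r`. -/
theorem exists_mul_add_mul_derivative_eq_C [CharZero K] {H : K[X][Y]} (hH : Prime H)
    (hd : H.natDegree ≠ 0) :
    ∃ (U W : K[X][Y]) (r : K[X]), r ≠ 0 ∧ U * H + W * derivative H = C r := by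
  have hprim : H.IsPrimitive := hH.irreducible.isPrimitive hd
  have hirr : Irreducible (H.map (algebraMap K[X] (RatFunc K))) :=
    (hprim.irreducible_iff_irreducible_map_fraction_map).1 hH.irreducible
  obtain ⟨a, b, hab⟩ := hirr.separable
  obtain ⟨m, hm, ha⟩ := IsLocalization.integerNormalization_spec (nonZeroDivisors K[X]) a
  obtain ⟨n, hn, hb⟩ := IsLocalization.integerNormalization_spec (nonZeroDivisors K[X]) b
  set A := IsLocalization.integerNormalization (nonZeroDivisors K[X]) a
  set B := IsLocalization.integerNormalization (nonZeroDivisors K[X]) b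
  refine ⟨C n * A, C m * B, m * n, mul_ne_zero (nonZeroDivisors.ne_zero hm)
    (nonZeroDivisors.ne_zero hn), ?_⟩
  apply Polynomial.map_injective (algebraMap K[X] (RatFunc K)) (IsFractionRing.injective _ _)
  simp only [Polynomial.map_add, Polynomial.map_mul, ha, hb, Polynomial.map_C, map_mul]
  rw [← derivative_map]
  rw [Algebra.smul_def, Algebra.smul_def]
  simp only [Polynomial.algebraMap_apply]
  linear_combination C (algebraMap K[X] (RatFunc K) m) * C (algebraMap K[X] (RatFunc K) n) * hab

theorem finite_verticalTangencies [CharZero K] (F : K[X][Y]) : (verticalTangencies F).Finite := by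
  induction F using UniqueFactorizationMonoid.induction_on_prime with
  | h₁ =>
    convert Set.finite_empty
    simp [verticalTangencies]
  | h₂ u hu =>
    convert Set.finite_empty
    ext x
    simp only [verticalTangencies, Set.mem_ofPred_eq, Set.mem_empty_iff_false, iff_false]
    rintro ⟨y, h0, -⟩
    exact (hu.map (evalEvalRingHom x y)).ne_zero h0
  | h₃ a p ha hp ih =>
    refine Set.Finite.subset (Set.Finite.union ?_ ih) (verticalTangencies_mul_subset p a)
    -- A prime factor in `X` alone vanishes only on vertical lines, which the last condition of
    -- `verticalTangencies` discards.
    by_cases hd : p.natDegree = 0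
    · convert Set.finite_empty
      ext x
      simp only [verticalTangencies, Set.mem_ofPred_eq, Set.mem_empty_iff_false, iff_false]
      rintro ⟨y, h0, -, -, hm⟩
      rw [natDegree_eq_zero] at hd
      obtain ⟨r, rfl⟩ := hd
      rw [evalEval_C] at h0
      simp [h0] at hm
    · obtain ⟨U, W, r, hr, h⟩ := exists_mul_add_mul_derivative_eq_C hp hd
      refine (Polynomial.finite_setOfPred_isRoot hr).subset ?_
      rintro x ⟨y, h0, hy, -⟩
      have := congrArg (evalEval x y) h
      rw [evalEval_add, evalEval_mul, evalEval_mul, h0, hy, evalEval_C] at this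
      simpa using this.symm

end Algebra

/-! ### Local structure of a plane curve over the `x`-axis -/

section PlaneCurve

/-- The zero locus in the plane of a polynomial in two variables. -/
def zeroLocus (G : ℝ[X][Y]) : Set (ℝ × ℝ) :=
  {z | G.evalEval z.1 z.2 = 0}

theorem continuous_evalEval (G : ℝ[X][Y]) : Continuous fun z : ℝ × ℝ => G.evalEval z.1 z.2 := by
  induction G using Polynomial.induction_on' with
  | add p q hp hq => simpa only [evalEval_add] using! hp.add hq
  | monomial n a =>
    simp only [evalEval, eval_monomial, eval_mul, eval_pow, eval_C]
    exact (a.continuous.comp continuous_fst).mul (continuous_snd.pow n)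

theorem isClosed_zeroLocus (G : ℝ[X][Y]) : IsClosed (zeroLocus G) :=
  isClosed_eq (continuous_evalEval G) continuous_const

theorem hasDerivAt_evalEval (G : ℝ[X][Y]) (x y : ℝ) :
    HasDerivAt (fun y => G.evalEval x y) ((derivative G).evalEval x y) y := by
  have h : ∀ (F : ℝ[X][Y]) (y : ℝ), F.evalEval x y = (F.map (evalRingHom x)).eval y := fun F y => by
    rw [eval_map, eval₂_evalRingHom]
  simp only [h]
  rw [← derivative_map]
  exact Polynomial.hasDerivAt _ _

theorem isPreconnected_of_isCompact_of_injOn {α β : Type*} [TopologicalSpace α]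
    [TopologicalSpace β] [T2Space β] {f : α → β} {s : Set α} (hs : IsCompact s)
    (hf : ContinuousOn f s) (hi : Set.InjOn f s) (hc : IsPreconnected (f '' s)) :
    IsPreconnected s := by
  have : CompactSpace s := isCompact_iff_compactSpace.1 hs
  have he : IsClosedEmbedding (s.domRestrict f) :=
    (continuousOn_iff_continuous_domRestrict.1 hf).isClosedEmbedding (Set.injOn_iff_injective.1 hi)
  rw [isPreconnected_iff_preconnectedSpace]
  refine ⟨?_⟩
  rw [← he.isInducing.isPreconnected_image, Set.image_univ, Set.range_domRestrict]
  exact hc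

/-- A quantitative implicit function theorem: in a small box `G` is strictly monotone in `y` and has
opposite signs on the horizontal sides. -/
theorem exists_box_of_derivative_ne_zero (G : ℝ[X][Y]) {x₀ y₀ : ℝ} (h0 : G.evalEval x₀ y₀ = 0)
    (hy : (derivative G).evalEval x₀ y₀ ≠ 0) {η : ℝ} (hη : 0 < η) :
    ∃ δ > 0, ∃ ε > 0, ε ≤ η ∧
      Set.InjOn Prod.fst
        (zeroLocus G ∩ Set.Icc (x₀ - δ) (x₀ + δ) ×ˢ Set.Icc (y₀ - ε) (y₀ + ε)) ∧
      Prod.fst '' (zeroLocus G ∩ Set.Icc (x₀ - δ) (x₀ + δ) ×ˢ Set.Icc (y₀ - ε) (y₀ + ε)) =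
        Set.Icc (x₀ - δ) (x₀ + δ) := by
  wlog hpos : 0 < (derivative G).evalEval x₀ y₀ generalizing G
  · have := this (-G) (by simpa using h0) (by simpa using hy)
      (by simpa using lt_of_le_of_ne (not_lt.1 hpos) hy)
    simpa [zeroLocus] using this
  obtain ⟨r, hr, hball⟩ := Metric.isOpen_iff.1
    (isOpen_lt continuous_const (continuous_evalEval (derivative G))) (x₀, y₀) hpos
  set ε := min η (r / 2) with hε
  have hε0 : 0 < ε := by positivity
  have hεη : ε ≤ η := min_le_left _ _
  have hεr : ε < r := (min_le_right _ _).trans_lt (half_lt_self hr)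
  have hmono : ∀ x, |x - x₀| < r →
      StrictMonoOn (fun y => G.evalEval x y) (Set.Icc (y₀ - ε) (y₀ + ε)) := by
    intro x hx
    refine strictMonoOn_of_deriv_pos (convex_Icc _ _)
      (fun y _ => (hasDerivAt_evalEval G x y).continuousAt.continuousWithinAt) fun y hy => ?_
    rw [interior_Icc] at hy
    rw [(hasDerivAt_evalEval G x y).deriv]
    refine hball (?_ : (x, y) ∈ _)
    rw [Metric.mem_ball, Prod.dist_eq, max_lt_iff, Real.dist_eq, Real.dist_eq]
    exact ⟨hx, abs_lt.2 ⟨by linarith [hy.1], by linarith [hy.2]⟩⟩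
  have hm := hmono x₀ (by simpa using hr)
  have hlow : G.evalEval x₀ (y₀ - ε) < 0 := by
    rw [← h0]
    exact hm ⟨le_rfl, by linarith⟩ ⟨by linarith, by linarith⟩ (by linarith)
  have hupp : 0 < G.evalEval x₀ (y₀ + ε) := by
    rw [← h0]
    exact hm ⟨by linarith, by linarith⟩ ⟨by linarith, le_rfl⟩ (by linarith)
  have hc : ∀ y, Continuous fun x => G.evalEval x y := fun y =>
    (continuous_evalEval G).comp (continuous_id.prodMk continuous_const)
  have hev : ∀ᶠ x in 𝓝 x₀, |x - x₀| < r ∧ G.evalEval x (y₀ - ε) < 0 ∧ 0 < G.evalEval x (y₀ + ε) :=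
    Filter.Eventually.and (Metric.ball_mem_nhds x₀ hr) (((hc _).continuousAt.eventually_lt_const hlow).and
      ((hc _).continuousAt.eventually_const_lt hupp))
  obtain ⟨δ, hδ, hb⟩ := Metric.nhds_basis_closedBall.eventually_iff.1 hev
  rw [Real.closedBall_eq_Icc] at hb
  refine ⟨δ, hδ, ε, hε0, hεη, ?_, ?_⟩
  · rintro ⟨x, y⟩ ⟨hz, hx, hy⟩ ⟨x', y'⟩ ⟨hz', hx', hy'⟩ (rfl : x = x')
    exact Prod.ext rfl ((hmono x (hb hx).1).injOn hy hy' (hz.trans hz'.symm))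
  · refine subset_antisymm (Set.image_subset_iff.2 fun z hz => hz.2.1) fun x hx => ?_
    obtain ⟨-, h1, h2⟩ := hb hx
    obtain ⟨y, hy, hyz⟩ := intermediate_value_Icc (by linarith : y₀ - ε ≤ y₀ + ε)
      ((continuous_evalEval G).comp (Continuous.prodMk_right x)).continuousOn ⟨h1.le, h2.le⟩
    exact ⟨(x, y), ⟨hyz, hx, hy⟩, rfl⟩

theorem exists_isOpen_isEmbedding_fst (G : ℝ[X][Y]) {z : ℝ × ℝ} (h0 : z ∈ zeroLocus G)
    (hy : (derivative G).evalEval z.1 z.2 ≠ 0) :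
    ∃ U, IsOpen U ∧ z ∈ U ∧ IsEmbedding ((U ∩ zeroLocus G).domRestrict Prod.fst) := by
  obtain ⟨δ, hδ, ε, hε, -, hinj, -⟩ := exists_box_of_derivative_ne_zero G h0 hy one_pos
  set B := zeroLocus G ∩ Set.Icc (z.1 - δ) (z.1 + δ) ×ˢ Set.Icc (z.2 - ε) (z.2 + ε)
  have hB : IsCompact B := (isCompact_Icc.prod isCompact_Icc).inter_left (isClosed_zeroLocus G)
  have : CompactSpace B := isCompact_iff_compactSpace.1 hB
  have he : IsClosedEmbedding (B.domRestrict Prod.fst) :=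
    (continuous_fst.comp continuous_subtype_val).isClosedEmbedding (Set.injOn_iff_injective.1 hinj)
  have hsub : Set.Ioo (z.1 - δ) (z.1 + δ) ×ˢ Set.Ioo (z.2 - ε) (z.2 + ε) ∩ zeroLocus G ⊆ B :=
    fun w hw => ⟨hw.2, Set.Ioo_subset_Icc_self hw.1.1, Set.Ioo_subset_Icc_self hw.1.2⟩
  exact ⟨Set.Ioo (z.1 - δ) (z.1 + δ) ×ˢ Set.Ioo (z.2 - ε) (z.2 + ε), isOpen_Ioo.prod isOpen_Ioo,
    ⟨⟨by linarith, by linarith⟩, ⟨by linarith, by linarith⟩⟩,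
    he.isEmbedding.comp (IsEmbedding.inclusion hsub)⟩

/-- The curve inside the box projects homeomorphically onto an interval, so it is connected and
stays in the component of `z`. -/
theorem eventually_exists_mem_connectedComponentIn (G : ℝ[X][Y]) {p z : ℝ × ℝ}
    (hz : z ∈ connectedComponentIn (zeroLocus G) p)
    (hy : (derivative G).evalEval z.1 z.2 ≠ 0) {η : ℝ} (hη : 0 < η) :
    ∀ᶠ x in 𝓝 z.1, ∃ y, |y - z.2| ≤ η ∧ (x, y) ∈ connectedComponentIn (zeroLocus G) p := by
  have h0 : z ∈ zeroLocus G := connectedComponentIn_subset _ _ hz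
  obtain ⟨δ, hδ, ε, hε, hεη, hinj, him⟩ := exists_box_of_derivative_ne_zero G h0 hy hη
  set B := zeroLocus G ∩ Set.Icc (z.1 - δ) (z.1 + δ) ×ˢ Set.Icc (z.2 - ε) (z.2 + ε)
  have hB : IsCompact B := (isCompact_Icc.prod isCompact_Icc).inter_left (isClosed_zeroLocus G)
  have hconn : IsPreconnected B := isPreconnected_of_isCompact_of_injOn hB
    continuous_fst.continuousOn hinj (him ▸ isPreconnected_Icc)
  have hsub : B ⊆ connectedComponentIn (zeroLocus G) p := by
    rw [connectedComponentIn_eq hz]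
    exact hconn.subset_connectedComponentIn
      ⟨h0, ⟨by linarith, by linarith⟩, ⟨by linarith, by linarith⟩⟩ Set.inter_subset_left
  filter_upwards [Icc_mem_nhds (by linarith : z.1 - δ < z.1) (by linarith : z.1 < z.1 + δ)]
    with x hx
  obtain ⟨⟨x', y⟩, hw, rfl⟩ := him.symm ▸ hx
  refine ⟨y, ?_, hsub hw⟩
  exact abs_le.2 ⟨by linarith [hw.2.2.1], by linarith [hw.2.2.2]⟩

/-- A large root `y` of `G` gives a root `1/y` of `G.reverse` near `0`, but `G.reverse` takes at
`(x₀, 0)` the non-zero value of the leading coefficient. -/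
theorem exists_bound_of_leadingCoeff_ne_zero (G : ℝ[X][Y]) {x₀ : ℝ}
    (h : G.leadingCoeff.eval x₀ ≠ 0) :
    ∃ M : ℝ, ∀ᶠ x in 𝓝 x₀, ∀ y, (x, y) ∈ zeroLocus G → |y| ≤ M := by
  have h0 : (G.reverse).evalEval x₀ 0 ≠ 0 := by
    rw [evalEval, C_0, ← coeff_zero_eq_eval_zero, coeff_zero_reverse]
    exact h
  obtain ⟨r, hr, hball⟩ := Metric.isOpen_iff.1
    (isOpen_ne_fun (continuous_evalEval G.reverse) continuous_const) (x₀, 0) h0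
  refine ⟨r⁻¹, ?_⟩
  filter_upwards [Metric.ball_mem_nhds x₀ hr] with x hx y hy
  by_contra! hlt
  have hy0 : 0 < |y| := (inv_pos.2 hr).trans hlt
  have hmem : (x, y⁻¹) ∈ Metric.ball (x₀, (0 : ℝ)) r := by
    rw [Metric.mem_ball, Prod.dist_eq, max_lt_iff]
    refine ⟨hx, ?_⟩
    rw [dist_zero_right, Real.norm_eq_abs, abs_inv]
    exact inv_lt_of_inv_lt₀ hr hlt
  refine hball hmem ?_
  have hu : y ≠ 0 := abs_pos.1 hy0
  let := invertibleOfNonzero hu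
  rw [← eval₂_evalRingHom, ← invOf_eq_inv y, eval₂_reverse_eq_zero_iff, eval₂_evalRingHom]
  exact hy

end PlaneCurve

/-! ### Unbounded closed sets and vertical asymptotes -/

section Arcs

variable {K : Set (ℝ × ℝ)}

theorem exists_mem_of_frequently_mem (hK : IsClosed K) {x₀ a b : ℝ}
    (h : ∃ᶠ x in 𝓝 x₀, ∃ y ∈ Set.Icc a b, (x, y) ∈ K) : ∃ y ∈ Set.Icc a b, (x₀, y) ∈ K := by
  set S := K ∩ Set.Icc (x₀ - 1) (x₀ + 1) ×ˢ Set.Icc a b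
  have hS : IsCompact S := (isCompact_Icc.prod isCompact_Icc).inter_left hK
  have hc : IsClosed (Prod.fst '' S) := (hS.image continuous_fst).isClosed
  have hx : x₀ ∈ Prod.fst '' S := by
    rw [← hc.closure_eq, mem_closure_iff_frequently]
    refine (h.and_eventually (Icc_mem_nhds (sub_one_lt x₀) (lt_add_one x₀))).mono ?_
    rintro x ⟨⟨y, hy, hz⟩, hx⟩
    exact ⟨(x, y), ⟨hz, hx, hy⟩, rfl⟩
  obtain ⟨⟨x, y⟩, hz, rfl⟩ := hx
  exact ⟨y, hz.2.2, hz.1⟩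

/-- By `hlsc` the abscissae of `K` form an open set and the top ordinate is lower semicontinuous; by
closedness and `hbd` this set is also closed in the interval and the top ordinate upper
semicontinuous. -/
theorem exists_continuousOn_max (hK : IsClosed K) {t u : ℝ}
    (hlsc : ∀ x₀ ∈ Set.Ioo t u, ∀ y₀, (x₀, y₀) ∈ K → ∀ η > 0,
      ∀ᶠ x in 𝓝 x₀, ∃ y, |y - y₀| ≤ η ∧ (x, y) ∈ K)
    (hbd : ∀ x₀ ∈ Set.Ioo t u, ∃ M : ℝ, ∀ᶠ x in 𝓝 x₀, ∀ y, (x, y) ∈ K → |y| ≤ M)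
    (hne : ∃ x ∈ Set.Ioo t u, ∃ y, (x, y) ∈ K) :
    ∃ g : ℝ → ℝ, ContinuousOn g (Set.Ioo t u) ∧
      ∀ x ∈ Set.Ioo t u, IsGreatest {y | (x, y) ∈ K} (g x) := by
  have hnonempty : Set.Ioo t u ⊆ {x | x ∈ Set.Ioo t u ∧ ∃ y, (x, y) ∈ K} := by
    refine isPreconnected_Ioo.subset_of_closure_inter_subset ?_ ?_ ?_
    · rw [isOpen_iff_mem_nhds]
      rintro x ⟨hx, y, hy⟩
      filter_upwards [isOpen_Ioo.mem_nhds hx, hlsc x hx y hy 1 one_pos] with x' hx' ⟨y', _, hy'⟩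
      exact ⟨hx', y', hy'⟩
    · obtain ⟨x, hx, hy⟩ := hne
      exact ⟨x, hx, hx, hy⟩
    · rintro x ⟨hx, hxu⟩
      obtain ⟨M, hM⟩ := hbd x hxu
      obtain ⟨y, -, hy⟩ := exists_mem_of_frequently_mem hK (x₀ := x) (a := -M) (b := M)
        (((mem_closure_iff_frequently.1 hx).and_eventually hM).mono
          fun x' ⟨⟨_, y, hy⟩, h⟩ => ⟨y, abs_le.1 (h y hy), hy⟩)
      exact ⟨hxu, y, hy⟩
  have hgreat : ∀ x ∈ Set.Ioo t u, IsGreatest {y | (x, y) ∈ K} (sSup {y | (x, y) ∈ K}) := by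
    intro x hx
    obtain ⟨M, hM⟩ := hbd x hx
    have hb : BddAbove {y | (x, y) ∈ K} := ⟨M, fun y hy => (abs_le.1 (hM.self_of_nhds y hy)).2⟩
    exact ⟨(hK.preimage (Continuous.prodMk_right x)).csSup_mem (hnonempty hx).2 hb,
      fun y hy => le_csSup hb hy⟩
  refine ⟨fun x => sSup {y | (x, y) ∈ K}, fun x hx => ContinuousAt.continuousWithinAt ?_, hgreat⟩
  refine tendsto_order.2 ⟨fun c hc => ?_, fun c hc => ?_⟩
  · have hη : 0 < (sSup {y | (x, y) ∈ K} - c) / 2 := half_pos (sub_pos.2 hc)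
    filter_upwards [isOpen_Ioo.mem_nhds hx, hlsc x hx _ (hgreat x hx).1 _ hη] with x' hx' ⟨y, hy, hyK⟩
    have h1 := (hgreat x' hx').2 hyK
    have h2 := (abs_le.1 hy).1
    linarith
  · obtain ⟨M, hM⟩ := hbd x hx
    by_contra hcon
    obtain ⟨y, hy, hyK⟩ := exists_mem_of_frequently_mem hK (x₀ := x) (a := c) (b := M)
      (((not_eventually.1 hcon).and_eventually (hM.and (isOpen_Ioo.mem_nhds hx))).mono
        fun x' ⟨h1, h2, h3⟩ => ⟨_, ⟨not_lt.1 h1, (abs_le.1 (h2 _ (hgreat x' h3).1)).2⟩,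
          (hgreat x' h3).1⟩)
    exact absurd (hy.1.trans ((hgreat x hx).2 hyK)) (not_le.2 hc)

theorem hasVerticalAsymptote_of_right_top (hK : IsClosed K) {t : ℝ}
    (hfin : {y | (t, y) ∈ K}.Finite)
    (hlsc : ∀ᶠ x₀ in 𝓝[>] t, ∀ y₀, (x₀, y₀) ∈ K → ∀ η > 0,
      ∀ᶠ x in 𝓝 x₀, ∃ y, |y - y₀| ≤ η ∧ (x, y) ∈ K)
    (hbd : ∀ᶠ x₀ in 𝓝[>] t, ∃ M : ℝ, ∀ᶠ x in 𝓝 x₀, ∀ y, (x, y) ∈ K → |y| ≤ M)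
    (hunb : ∀ M : ℝ, ∃ᶠ x in 𝓝[>] t, ∃ y, M < y ∧ (x, y) ∈ K) :
    HasVerticalAsymptote Prod.fst K := by
  obtain ⟨u, hu, hsub⟩ := mem_nhdsGT_iff_exists_Ioo_subset.1 (hlsc.and hbd)
  replace hu : t < u := hu
  have hev : ∀ v > t, ∀ᶠ x in 𝓝[>] t, x ∈ Set.Ioo t v := fun v hv => Ioo_mem_nhdsGT hv
  obtain ⟨g, hg, hmax⟩ := exists_continuousOn_max hK (fun x hx => (hsub hx).1)
    (fun x hx => (hsub hx).2) (by
      obtain ⟨x, ⟨y, -, hy⟩, hx⟩ := ((hunb 0).and_eventually (hev u hu)).exists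
      exact ⟨x, hx, y, hy⟩)
  have htop : Tendsto g (𝓝[>] t) atTop := by
    by_contra hcon
    obtain ⟨M, hM⟩ := not_forall.1 (mt tendsto_atTop.2 hcon)
    -- Near `t` the function `g` is sometimes below `M` and sometimes above `c`, so it equals `c` at
    -- points tending to `t`; closedness puts `(t, c)` in `K`.
    refine (Set.Ioi_infinite M).mono (fun c (hc : M < c) => ?_) hfin
    have hfreq : ∃ᶠ x in 𝓝[>] t, g x = c := by
      refine frequently_iff.2 fun {U} hU => ?_
      obtain ⟨v, hv, hvU⟩ := mem_nhdsGT_iff_exists_Ioo_subset.1 hU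
      replace hv : t < v := hv
      have hw : Set.Ioo t (min u v) ⊆ Set.Ioo t u := Set.Ioo_subset_Ioo_right (min_le_left _ _)
      obtain ⟨x₁, h1, hx₁⟩ := ((not_eventually.1 hM).and_eventually
        (hev (min u v) (lt_min hu hv))).exists
      obtain ⟨x₂, ⟨y, hcy, hy⟩, hx₂⟩ := ((hunb c).and_eventually
        (hev (min u v) (lt_min hu hv))).exists
      obtain ⟨x, hx, hxc⟩ := isPreconnected_Ioo.intermediate_value hx₁ hx₂ (hg.mono hw)
        ⟨(not_le.1 h1).le.trans hc.le, hcy.le.trans ((hmax x₂ (hw hx₂)).2 hy)⟩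
      exact ⟨x, hvU ⟨hx.1, hx.2.trans_le (min_le_right _ _)⟩, hxc⟩
    obtain ⟨y, hy, hyK⟩ := exists_mem_of_frequently_mem hK (x₀ := t) (a := c) (b := c)
      (((hfreq.and_eventually (hev u hu)).filter_mono nhdsWithin_le_nhds).mono
        fun x ⟨hxc, hx⟩ => ⟨c, ⟨le_rfl, le_rfl⟩, hxc ▸ (hmax x hx).1⟩)
    rw [Set.Icc_self] at hy
    exact hy ▸ hyK
  -- The constant `2` keeps `f 0` strictly below `u`.
  set f : NNReal → ℝ := fun s => t + (u - t) / (2 + s) with hf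
  have hpos : ∀ s : NNReal, (0 : ℝ) < 2 + s := fun s => by positivity
  have hut : 0 < u - t := sub_pos.2 hu
  have hfmem : ∀ s, f s ∈ Set.Ioo t u := by
    intro s
    have h1 : 0 < (u - t) / (2 + s) := div_pos hut (hpos s)
    have h2 : (u - t) / (2 + s) < u - t := div_lt_self hut (by linarith [s.coe_nonneg])
    exact ⟨by linarith, by linarith⟩
  have hfc : Continuous f :=
    continuous_const.add (continuous_const.div
      (continuous_const.add NNReal.continuous_coe) fun s => (hpos s).ne')
  have hfinj : Function.Injective f := by
    intro s s' h
    have h' := add_left_cancel h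
    rw [div_eq_div_iff (hpos s).ne' (hpos s').ne'] at h'
    have := mul_left_cancel₀ hut.ne' h'
    exact NNReal.coe_injective (by linarith)
  have hft : Tendsto f atTop (𝓝 t) := by
    have h1 : Tendsto (fun s : NNReal => (2 : ℝ) + s) atTop atTop :=
      tendsto_atTop_add_const_left _ _ (NNReal.tendsto_coe_atTop.2 tendsto_id)
    simpa using tendsto_const_nhds.add (h1.const_div_atTop (u - t))
  have hfgt : Tendsto f atTop (𝓝[>] t) :=
    tendsto_nhdsWithin_iff.2 ⟨hft, Eventually.of_forall fun s => (hfmem s).1⟩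
  refine ⟨t, fun s => (f s, g (f s)), hfc.prodMk (hg.comp_continuous hfc hfmem),
    fun s s' h => hfinj (congrArg Prod.fst h), fun s => (hmax _ (hfmem s)).1, ?_, hft⟩
  rw [← Metric.cobounded_eq_cocompact, ← tendsto_norm_atTop_iff_cobounded]
  exact tendsto_atTop_mono (fun s => (le_abs_self _).trans (le_max_right _ _)) (htop.comp hfgt)

theorem HasVerticalAsymptote.of_preimage (φ : (ℝ × ℝ) ≃ₜ (ℝ × ℝ)) {r : ℝ → ℝ} (hr : Continuous r)
    (hφ : ∀ z, (φ z).1 = r z.1) (h : HasVerticalAsymptote Prod.fst (φ ⁻¹' K)) :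
    HasVerticalAsymptote Prod.fst K := by
  obtain ⟨t, γ, hc, hi, hm, hinf, ht⟩ := h
  refine ⟨r t, φ ∘ γ, φ.continuous.comp hc, φ.injective.comp hi, hm,
    φ.isClosedEmbedding.tendsto_cocompact.comp hinf, ?_⟩
  simp only [Function.comp_apply, hφ]
  exact (hr.tendsto t).comp ht

theorem hasVerticalAsymptote_of_right (hK : IsClosed K) {t : ℝ}
    (hfin : {y | (t, y) ∈ K}.Finite)
    (hlsc : ∀ᶠ x₀ in 𝓝[>] t, ∀ y₀, (x₀, y₀) ∈ K → ∀ η > 0,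
      ∀ᶠ x in 𝓝 x₀, ∃ y, |y - y₀| ≤ η ∧ (x, y) ∈ K)
    (hbd : ∀ᶠ x₀ in 𝓝[>] t, ∃ M : ℝ, ∀ᶠ x in 𝓝 x₀, ∀ y, (x, y) ∈ K → |y| ≤ M)
    (hunb : ∀ M : ℝ, ∃ᶠ x in 𝓝[>] t, ∃ y, M < |y| ∧ (x, y) ∈ K) :
    HasVerticalAsymptote Prod.fst K := by
  by_cases htop : ∀ M : ℝ, ∃ᶠ x in 𝓝[>] t, ∃ y, M < y ∧ (x, y) ∈ K
  · exact hasVerticalAsymptote_of_right_top hK hfin hlsc hbd htop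
  obtain ⟨M₀, hM₀⟩ := not_forall.1 htop
  rw [not_frequently] at hM₀
  let φ : (ℝ × ℝ) ≃ₜ (ℝ × ℝ) := (Homeomorph.refl ℝ).prodCongr (Homeomorph.neg ℝ)
  refine HasVerticalAsymptote.of_preimage φ continuous_id (fun z => rfl)
    (hasVerticalAsymptote_of_right_top (t := t) (hK.preimage φ.continuous) ?_ ?_ ?_ ?_)
  · have h := hfin.preimage (f := Neg.neg) neg_injective.injOn
    exact h
  · filter_upwards [hlsc] with x₀ h y₀ hy η hη
    filter_upwards [h (-y₀) hy η hη] with x ⟨y, hy, hxy⟩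
    refine ⟨-y, ?_, ?_⟩
    · rwa [← abs_neg, neg_sub, sub_neg_eq_add, add_comm, ← sub_neg_eq_add]
    · change (x, - -y) ∈ K
      rwa [neg_neg]
  · filter_upwards [hbd] with x₀ ⟨M, hM⟩
    refine ⟨M, hM.mono fun x h y hy => ?_⟩
    simpa using h (-y) hy
  · intro M
    -- Ordinates near `t` are at most `M₀`, so `|y| > M₀` forces `y` to be negative.
    refine ((hunb (max M M₀)).and_eventually hM₀).mono ?_
    rintro x ⟨⟨y, hy, hxy⟩, hn⟩
    obtain ⟨h1, h2⟩ := max_lt_iff.1 hy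
    refine ⟨-y, ?_, ?_⟩
    · rcases abs_choice y with h | h
      · exact absurd ⟨y, h ▸ h2, hxy⟩ hn
      · exact h ▸ h1
    · change (x, - -y) ∈ K
      rwa [neg_neg]

theorem eventually_abs_le_or_hasVerticalAsymptote (hK : IsClosed K) {t : ℝ}
    (hfin : {y | (t, y) ∈ K}.Finite)
    (hlsc : ∀ᶠ x₀ in 𝓝[≠] t, ∀ y₀, (x₀, y₀) ∈ K → ∀ η > 0,
      ∀ᶠ x in 𝓝 x₀, ∃ y, |y - y₀| ≤ η ∧ (x, y) ∈ K)
    (hbd : ∀ᶠ x₀ in 𝓝[≠] t, ∃ M : ℝ, ∀ᶠ x in 𝓝 x₀, ∀ y, (x, y) ∈ K → |y| ≤ M) :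
    (∃ M : ℝ, ∀ᶠ x in 𝓝 t, ∀ y, (x, y) ∈ K → |y| ≤ M) ∨ HasVerticalAsymptote Prod.fst K := by
  have hle : 𝓝[>] t ≤ 𝓝[≠] t := nhdsWithin_mono _ fun x hx => ne_of_gt hx
  by_cases hR : ∀ M : ℝ, ∃ᶠ x in 𝓝[>] t, ∃ y, M < |y| ∧ (x, y) ∈ K
  · exact Or.inr (hasVerticalAsymptote_of_right hK hfin (hlsc.filter_mono hle)
      (hbd.filter_mono hle) hR)
  by_cases hL : ∀ M : ℝ, ∃ᶠ x in 𝓝[<] t, ∃ y, M < |y| ∧ (x, y) ∈ K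
  · right
    let φ : (ℝ × ℝ) ≃ₜ (ℝ × ℝ) := (Homeomorph.neg ℝ).prodCongr (Homeomorph.refl ℝ)
    have hneg : Tendsto (fun x : ℝ => -x) (𝓝[>] (-t)) (𝓝[<] t) := by
      simpa using tendsto_neg_nhdsGT (a := -t)
    have hneg' : Tendsto (fun x : ℝ => -x) (𝓝[<] t) (𝓝[>] (-t)) := tendsto_neg_nhdsLT
    have hle' : 𝓝[<] t ≤ 𝓝[≠] t := nhdsWithin_mono _ fun x hx => ne_of_lt hx
    refine HasVerticalAsymptote.of_preimage φ continuous_neg (fun z => rfl)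
      (hasVerticalAsymptote_of_right (t := -t) (hK.preimage φ.continuous) ?_ ?_ ?_ ?_)
    · change {y | (- -t, y) ∈ K}.Finite
      rwa [neg_neg]
    · filter_upwards [hneg.eventually (hlsc.filter_mono hle')] with x₀ h y₀ hy η hη
      exact (continuous_neg.tendsto x₀).eventually (h y₀ hy η hη)
    · filter_upwards [hneg.eventually (hbd.filter_mono hle')] with x₀ ⟨M, hM⟩
      exact ⟨M, (continuous_neg.tendsto x₀).eventually hM⟩
    · intro M
      refine hneg'.frequently ((hL M).mono ?_)
      rintro x ⟨y, hy, hxy⟩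
      refine ⟨y, hy, ?_⟩
      change (- -x, y) ∈ K
      rwa [neg_neg]
  left
  obtain ⟨M₁, h1⟩ := not_forall.1 hR
  obtain ⟨M₂, h2⟩ := not_forall.1 hL
  obtain ⟨M₃, h3⟩ := (hfin.image abs).bddAbove
  rw [not_frequently] at h1 h2
  refine ⟨max M₁ (max M₂ M₃), ?_⟩
  have h12 : ∀ᶠ x in 𝓝[≠] t, ∀ y, (x, y) ∈ K → |y| ≤ max M₁ (max M₂ M₃) := by
    rw [← Set.Iio_union_Ioi, nhdsWithin_union, eventually_sup]
    constructor
    · filter_upwards [h2] with x hx y hy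
      exact (not_lt.1 fun h => hx ⟨y, h, hy⟩).trans ((le_max_left _ _).trans (le_max_right _ _))
    · filter_upwards [h1] with x hx y hy
      exact (not_lt.1 fun h => hx ⟨y, h, hy⟩).trans (le_max_left _ _)
  filter_upwards [eventually_nhdsWithin_iff.1 h12] with x hx y hy
  by_cases hxt : x = t
  · subst hxt
    exact (h3 ⟨y, hy, rfl⟩).trans ((le_max_right _ _).trans (le_max_right _ _))
  · exact hx hxt y hy

end Arcs

/-! ### Smooth components without vertical lines -/

section SmoothComponent

theorem isClosed_connectedComponentIn {α : Type*} [TopologicalSpace α] {F : Set α}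
    (hF : IsClosed F) (x : α) : IsClosed (connectedComponentIn F x) := by
  by_cases hx : x ∈ F
  · exact isClosed_of_closure_subset (isPreconnected_connectedComponentIn.closure
      |>.subset_connectedComponentIn (subset_closure (mem_connectedComponentIn hx))
      (closure_minimal (connectedComponentIn_subset F x) hF))
  · rw [connectedComponentIn_eq_empty hx]
    exact isClosed_empty

variable {G : ℝ[X][Y]} {p : ℝ × ℝ}

theorem map_evalRingHom_ne_zero_of_mem_connectedComponentIn
    (hline : ¬ ContainsVerticalLine Prod.fst (connectedComponentIn (zeroLocus G) p))
    {z : ℝ × ℝ} (hz : z ∈ connectedComponentIn (zeroLocus G) p) :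
    G.map (evalRingHom z.1) ≠ 0 := by
  intro h0
  refine hline ⟨z.1, ?_⟩
  rw [connectedComponentIn_eq hz]
  refine IsPreconnected.subset_connectedComponentIn ?_ rfl ?_
  · have h : (Prod.fst ⁻¹' {z.1} : Set (ℝ × ℝ)) = Prod.mk z.1 '' Set.univ := by
      ext ⟨x, y⟩
      simp [eq_comm]
    rw [h]
    exact isPreconnected_univ.image _ (Continuous.prodMk_right z.1).continuousOn
  · rintro ⟨x, y⟩ (rfl : x = z.1)
    change G.evalEval z.1 y = 0
    rw [← eval₂_evalRingHom, ← eval_map, h0, eval_zero]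

theorem finite_fiber_connectedComponentIn
    (hline : ¬ ContainsVerticalLine Prod.fst (connectedComponentIn (zeroLocus G) p)) (x : ℝ) :
    {y | (x, y) ∈ connectedComponentIn (zeroLocus G) p}.Finite := by
  rcases Set.eq_empty_or_nonempty {y | (x, y) ∈ connectedComponentIn (zeroLocus G) p} with h | h
  · rw [h]
    exact Set.finite_empty
  obtain ⟨y₀, hy₀⟩ := h
  refine (finite_setOfPred_isRoot
    (map_evalRingHom_ne_zero_of_mem_connectedComponentIn hline hy₀)).subset fun y hy => ?_
  have h0 : G.evalEval x y = 0 := connectedComponentIn_subset (zeroLocus G) p hy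
  change (G.map (evalRingHom x)).eval y = 0
  rw [eval_map, eval₂_evalRingHom, h0]

theorem fst_mem_verticalTangencies
    (hsmooth : ∀ z ∈ connectedComponentIn (zeroLocus G) p,
      (derivative G).evalEval z.1 z.2 ≠ 0 ∨ (derivative (G.eval (C z.2))).eval z.1 ≠ 0)
    (hline : ¬ ContainsVerticalLine Prod.fst (connectedComponentIn (zeroLocus G) p))
    {z : ℝ × ℝ} (hz : z ∈ connectedComponentIn (zeroLocus G) p)
    (hy : (derivative G).evalEval z.1 z.2 = 0) : z.1 ∈ verticalTangencies G :=
  ⟨z.2, connectedComponentIn_subset (zeroLocus G) p hz, hy, (hsmooth z hz).resolve_left (not_not.2 hy),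
    map_evalRingHom_ne_zero_of_mem_connectedComponentIn hline hz⟩

theorem finite_derivative_eq_zero
    (hsmooth : ∀ z ∈ connectedComponentIn (zeroLocus G) p,
      (derivative G).evalEval z.1 z.2 ≠ 0 ∨ (derivative (G.eval (C z.2))).eval z.1 ≠ 0)
    (hline : ¬ ContainsVerticalLine Prod.fst (connectedComponentIn (zeroLocus G) p)) :
    {z ∈ connectedComponentIn (zeroLocus G) p | (derivative G).evalEval z.1 z.2 = 0}.Finite := by
  refine ((finite_verticalTangencies G).biUnion fun x _ =>
    (finite_fiber_connectedComponentIn hline x).image (Prod.mk x)).subset ?_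
  rintro z ⟨hz, hy⟩
  exact Set.mem_biUnion (fst_mem_verticalTangencies hsmooth hline hz hy) ⟨z.2, hz, rfl⟩

/-- The exceptional abscissae, namely vertical tangencies and roots of the leading coefficient, are
finite in number, so a punctured neighbourhood of `t` avoids them even if `t` is one of them. -/
theorem eventually_abs_le_connectedComponentIn
    (hsmooth : ∀ z ∈ connectedComponentIn (zeroLocus G) p,
      (derivative G).evalEval z.1 z.2 ≠ 0 ∨ (derivative (G.eval (C z.2))).eval z.1 ≠ 0)
    (hline : ¬ ContainsVerticalLine Prod.fst (connectedComponentIn (zeroLocus G) p))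
    (hasymp : ¬ HasVerticalAsymptote Prod.fst (connectedComponentIn (zeroLocus G) p)) (t : ℝ) :
    ∃ M : ℝ, ∀ᶠ x in 𝓝 t, ∀ y, (x, y) ∈ connectedComponentIn (zeroLocus G) p → |y| ≤ M := by
  by_cases hne : p ∈ zeroLocus G
  swap
  · exact ⟨0, Eventually.of_forall fun x y h => by
      rw [connectedComponentIn_eq_empty hne] at h
      exact h.elim⟩
  have hG : G ≠ 0 := by
    rintro rfl
    simpa using hsmooth p (mem_connectedComponentIn hne)
  have hfin : ∀ {S : Set ℝ}, S.Finite → ∀ᶠ x in 𝓝[≠] t, x ∉ S := fun {S} hS => by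
    filter_upwards [mem_nhdsWithin_of_mem_nhds
      ((hS.subset (Set.sdiff_subset (t := {t}))).isClosed.isOpen_compl.mem_nhds
        (fun h => h.2 rfl)), self_mem_nhdsWithin] with x hx hxt hxS
    exact hx ⟨hxS, hxt⟩
  refine (eventually_abs_le_or_hasVerticalAsymptote ?_
    (finite_fiber_connectedComponentIn hline t) ?_ ?_).resolve_right hasymp
  · exact isClosed_connectedComponentIn (isClosed_zeroLocus G) p
  · filter_upwards [hfin (finite_verticalTangencies G)] with x₀ hx₀ y₀ hy₀ η hη
    exact eventually_exists_mem_connectedComponentIn G hy₀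
      (fun h => hx₀ (fst_mem_verticalTangencies hsmooth hline hy₀ h)) hη
  · filter_upwards [hfin (finite_setOfPred_isRoot (leadingCoeff_ne_zero.2 hG))] with x₀ hx₀
    obtain ⟨M, hM⟩ := exists_bound_of_leadingCoeff_ne_zero G hx₀
    exact ⟨M, hM.mono fun x h y hy => h y (connectedComponentIn_subset _ _ hy)⟩

end SmoothComponent

/-! ### Changes of affine coordinates -/

section Coordinates

/-- The chain rule, needed for `∂/∂Y` on `ℝ[X][Y]` and, with `Y` frozen, for `d/dX` on `ℝ[X]`. -/
theorem derivation_aeval {σ A : Type*} [Fintype σ] [CommRing A] [Algebra ℝ A]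
    (d : Derivation ℝ A A) (f : σ → A) (F : MvPolynomial σ ℝ) :
    d (MvPolynomial.aeval f F) =
      ∑ i, MvPolynomial.aeval f (MvPolynomial.pderiv i F) * d (f i) := by
  classical
  induction F using MvPolynomial.induction_on with
  | C a => simp
  | add p q hp hq => simp [hp, hq, add_mul, Finset.sum_add_distrib]
  | mul_X p i hp =>
    simp only [map_mul, MvPolynomial.aeval_X, Derivation.leibniz, hp, smul_eq_mul, map_add,
      MvPolynomial.pderiv_X, add_mul, Finset.sum_add_distrib, Finset.mul_sum]
    congr 1
    · simp [Pi.single_apply, apply_ite, ite_mul]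
    · exact Finset.sum_congr rfl fun j _ => by ring

/-- A polynomial in affine coordinates of the plane becomes a polynomial in any other affine
coordinates, and smooth points of its zero locus remain smooth. -/
theorem exists_evalEval_eq_eval (L : (ℝ × ℝ) ≃ᵃ[ℝ] (Fin 2 → ℝ)) (F : MvPolynomial (Fin 2) ℝ) :
    ∃ G : ℝ[X][Y], (∀ z : ℝ × ℝ, G.evalEval z.1 z.2 = MvPolynomial.eval (L z) F) ∧
      ∀ z : ℝ × ℝ, (∃ i, MvPolynomial.eval (L z) (MvPolynomial.pderiv i F) ≠ 0) →
        (derivative G).evalEval z.1 z.2 ≠ 0 ∨ (derivative (G.eval (C z.2))).eval z.1 ≠ 0 := by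
  set a : Fin 2 → ℝ := L.linear (1, 0)
  set b : Fin 2 → ℝ := L.linear (0, 1)
  set c : Fin 2 → ℝ := L (0, 0)
  have hlin : ∀ x y : ℝ, L.linear (x, y) = x • a + y • b := fun x y => by
    rw [← map_smul, ← map_smul, ← map_add]
    simp
  have hL : ∀ (z : ℝ × ℝ) i, L z i = a i * z.1 + b i * z.2 + c i := fun z i => by
    have h : L z = L.linear z + c := by
      have h := L.map_vadd (0, 0) z
      rwa [vadd_eq_add, vadd_eq_add, Prod.mk_zero_zero, add_zero] at h
    rw [h, hlin z.1 z.2]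
    simp [mul_comm]
  set f : Fin 2 → ℝ[X][Y] := fun i => C (C (a i) * X) + C (C (b i)) * X + C (C (c i))
  have hev : ∀ (z : ℝ × ℝ) (F : MvPolynomial (Fin 2) ℝ),
      (MvPolynomial.aeval f F).evalEval z.1 z.2 = MvPolynomial.eval (L z) F := by
    intro z F
    induction F using MvPolynomial.induction_on with
    | C r => simp [evalEval]
    | add p q hp hq => simp only [map_add, evalEval_add, hp, hq]
    | mul_X p i hp =>
      rw [map_mul, evalEval_mul, hp, map_mul, MvPolynomial.aeval_X, MvPolynomial.eval_X, hL]
      simp [f, evalEval]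
  refine ⟨MvPolynomial.aeval f F, fun z => hev z F, fun z hz => ?_⟩
  -- If both partial derivatives vanish, the gradient of `F` annihilates `a` and `b`, which span the
  -- plane, so it is zero.
  by_contra! hcon
  obtain ⟨h1, h2⟩ := hcon
  have e1 : ∑ i, MvPolynomial.eval (L z) (MvPolynomial.pderiv i F) * b i = 0 := by
    have h := derivation_aeval ((derivative' (R := ℝ[X])).restrictScalars ℝ) f F
    rw [← h1]
    change derivative (MvPolynomial.aeval f F) =
      ∑ i, MvPolynomial.aeval f (MvPolynomial.pderiv i F) * derivative (f i) at h
    rw [h, evalEval_finsetSum]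
    refine Finset.sum_congr rfl fun i _ => ?_
    rw [evalEval_mul, hev]
    simp [f]
  have e2 : ∑ i, MvPolynomial.eval (L z) (MvPolynomial.pderiv i F) * a i = 0 := by
    set g : Fin 2 → ℝ[X] := fun i => (f i).eval (C z.2)
    have hg : ∀ F : MvPolynomial (Fin 2) ℝ,
        (MvPolynomial.aeval f F).eval (C z.2) = MvPolynomial.aeval g F := by
      intro F
      induction F using MvPolynomial.induction_on with
      | C r => simp
      | add p q hp hq => simp only [map_add, eval_add, hp, hq]
      | mul_X p i hp => rw [map_mul, eval_mul, hp, map_mul, MvPolynomial.aeval_X, MvPolynomial.aeval_X]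
    have h := derivation_aeval (derivative' (R := ℝ)) g F
    rw [← h2, hg]
    change derivative (MvPolynomial.aeval g F) =
      ∑ i, MvPolynomial.aeval g (MvPolynomial.pderiv i F) * derivative (g i) at h
    rw [h, eval_finsetSum]
    refine Finset.sum_congr rfl fun i _ => ?_
    rw [eval_mul, ← hg]
    change _ = (MvPolynomial.aeval f (MvPolynomial.pderiv i F)).evalEval z.1 z.2 * _
    rw [hev]
    simp [g, f]
  obtain ⟨i, hi⟩ := hz
  obtain ⟨⟨x, y⟩, hxy⟩ := L.linear.surjective (Pi.single i 1)
  rw [hlin] at hxy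
  have h : ∑ j, MvPolynomial.eval (L z) (MvPolynomial.pderiv j F) * (x • a + y • b) j = 0 := by
    simp only [Pi.add_apply, Pi.smul_apply, smul_eq_mul, mul_add, Finset.sum_add_distrib]
    simp only [mul_left_comm _ x, mul_left_comm _ y, ← Finset.mul_sum, e1, e2, mul_zero, add_zero]
  rw [hxy] at h
  exact hi (by simpa [Pi.single_apply] using h)

variable {V P : Type*} [AddCommGroup V] [Module ℝ V] [AddTorsor V P]

theorem exists_affineEquiv_fst_eq (hV : Module.finrank ℝ V = 2) (π : P →ᵃ[ℝ] ℝ)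
    (hπ : π.linear ≠ 0) : ∃ φ : P ≃ᵃ[ℝ] ℝ × ℝ, ∀ p, (φ p).1 = π p := by
  have : FiniteDimensional ℝ V := Module.finite_of_finrank_eq_succ hV
  have hsurj : Function.Surjective π.linear := LinearMap.surjective hπ
  have hker : Module.finrank ℝ (LinearMap.ker π.linear) = 1 := by
    have h := LinearMap.finrank_range_add_finrank_ker π.linear
    rw [LinearMap.range_eq_top.2 hsurj, finrank_top, Module.finrank_self, hV] at h
    omega
  obtain ⟨e⟩ := Module.nonempty_linearEquiv_of_finrank_eq_one hker
  obtain ⟨q, hq⟩ := (LinearMap.ker π.linear).subtype.exists_leftInverse_of_injective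
    (Submodule.ker_subtype _)
  -- The second coordinate is a projection onto the line `ker π.linear`, identified with `ℝ`.
  have hinj : Function.Injective (π.linear.prod (e.symm.toLinearMap ∘ₗ q)) := by
    rw [← LinearMap.ker_eq_bot, LinearMap.ker_eq_bot']
    intro v hv
    obtain ⟨h1, h2⟩ := Prod.mk.inj hv
    have h3 : q v = ⟨v, h1⟩ := LinearMap.congr_fun hq ⟨v, h1⟩
    have h4 : q v = 0 := e.symm.map_eq_zero_iff.1 h2
    exact congrArg Subtype.val (h3.symm.trans h4)
  let ψ : V ≃ₗ[ℝ] ℝ × ℝ := LinearEquiv.ofInjectiveOfFinrankEq _ hinj (by simp [hV])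
  obtain ⟨p₀⟩ : Nonempty P := inferInstance
  refine ⟨(AffineEquiv.vaddConst ℝ p₀).symm.trans
    (ψ.toAffineEquiv.trans (AffineEquiv.constVAdd ℝ (ℝ × ℝ) (π p₀, 0))), fun p => ?_⟩
  change π p₀ + π.linear (p -ᵥ p₀) = π p
  rw [AffineMap.linearMap_vsub]
  simp

variable [TopologicalSpace V] [IsTopologicalAddGroup V] [ContinuousSMul ℝ V] [T2Space V]
    [TopologicalSpace P] [IsTopologicalAddTorsor P]

theorem continuous_affineEquiv_prod (hV : Module.finrank ℝ V = 2) (φ : P ≃ᵃ[ℝ] ℝ × ℝ) :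
    Continuous φ ∧ Continuous φ.symm := by
  have : FiniteDimensional ℝ V := Module.finite_of_finrank_eq_succ hV
  exact ⟨AffineMap.continuous_linear_iff.1
    (LinearMap.continuous_of_finiteDimensional φ.toAffineMap.linear),
    AffineMap.continuous_linear_iff.1
    (LinearMap.continuous_of_finiteDimensional φ.symm.toAffineMap.linear)⟩

end Coordinates

/-! ### Properness, half-strips and critical points -/

section Projection

variable {P : Type*} [TopologicalSpace P] (φ : P ≃ₜ ℝ × ℝ) {D : Set P}

theorem isProperMap_domRestrict_iff (hD : IsClosed D) :
    IsProperMap (D.domRestrict fun p => (φ p).1) ↔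
      ∀ a b : ℝ, ∃ M : ℝ, ∀ p ∈ D, (φ p).1 ∈ Set.Icc a b → |(φ p).2| ≤ M := by
  have hc : Continuous fun p => (φ p).1 := continuous_fst.comp φ.continuous
  constructor
  · intro h a b
    have hS : IsCompact (D.domRestrict (fun p => (φ p).1) ⁻¹' Set.Icc a b) :=
      h.isCompact_preimage isCompact_Icc
    obtain ⟨M, hM⟩ := (hS.image (f := fun p : D => |(φ p).2|)
      ((continuous_snd.comp φ.continuous).comp continuous_subtype_val).abs).bddAbove
    exact ⟨M, fun p hp hab => hM ⟨⟨p, hp⟩, hab, rfl⟩⟩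
  · intro h
    refine isProperMap_iff_isCompact_preimage.2 ⟨hc.comp continuous_subtype_val, fun S hS => ?_⟩
    obtain ⟨a, ha⟩ := hS.bddBelow
    obtain ⟨b, hb⟩ := hS.bddAbove
    obtain ⟨M, hM⟩ := h a b
    have hbox : IsCompact (φ ⁻¹' (Set.Icc a b ×ˢ Set.Icc (-M) M)) :=
      φ.isCompact_preimage.2 (isCompact_Icc.prod isCompact_Icc)
    rw [Subtype.isCompact_iff]
    refine hbox.of_isClosed_subset ?_ ?_
    · exact hD.isClosedEmbedding_subtypeVal.isClosedMap _
        (hS.isClosed.preimage (hc.comp continuous_subtype_val))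
    · rintro _ ⟨⟨p, hp⟩, hpS, rfl⟩
      have hab : (φ p).1 ∈ Set.Icc a b := ⟨ha hpS, hb hpS⟩
      exact ⟨hab, abs_le.1 (hM p hp hab)⟩

theorem not_containsVerticalLine_of_bounded {C : Set P}
    (hC : ∀ a b : ℝ, ∃ M : ℝ, ∀ p ∈ C, (φ p).1 ∈ Set.Icc a b → |(φ p).2| ≤ M) :
    ¬ ContainsVerticalLine (fun p => (φ p).1) C := by
  rintro ⟨t, ht⟩
  obtain ⟨M, hM⟩ := hC t t
  have h := hM (φ.symm (t, |M| + 1)) (ht (by simp)) (by simp)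
  rw [φ.apply_symm_apply] at h
  have h1 := (le_abs_self (|M| + 1)).trans h
  linarith [le_abs_self M]

theorem not_hasVerticalAsymptote_of_bounded {C : Set P}
    (hC : ∀ a b : ℝ, ∃ M : ℝ, ∀ p ∈ C, (φ p).1 ∈ Set.Icc a b → |(φ p).2| ≤ M) :
    ¬ HasVerticalAsymptote (fun p => (φ p).1) C := by
  rintro ⟨t, γ, -, -, hm, hinf, ht⟩
  obtain ⟨M, hM⟩ := hC (t - 1) (t + 1)
  have hbox : IsCompact (φ ⁻¹' (Set.Icc (t - 1) (t + 1) ×ˢ Set.Icc (-M) M)) :=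
    φ.isCompact_preimage.2 (isCompact_Icc.prod isCompact_Icc)
  obtain ⟨s, h1, h2⟩ := ((hinf.eventually hbox.compl_mem_cocompact).and
    (ht.eventually (Icc_mem_nhds (sub_one_lt t) (lt_add_one t)))).exists
  exact h1 ⟨h2, abs_le.1 (hM _ (hm s) h2)⟩

/-- A connected set meeting the complement of `D` but not its frontier is disjoint from `D`. -/
theorem disjoint_of_disjoint_frontier {α : Type*} [TopologicalSpace α] {s D : Set α}
    (hs : IsPreconnected s) (hD : IsClosed D) (hd : Disjoint s (frontier D))
    (hne : (s ∩ Dᶜ).Nonempty) : Disjoint s D := by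
  rw [← Set.subset_compl_iff_disjoint_right]
  refine hs.subset_right_of_subset_union (u := interior D) isOpen_interior hD.isOpen_compl
    (Set.disjoint_compl_right_iff_subset.2 interior_subset) (fun x hx => ?_) hne
  by_cases hxD : x ∈ D
  · exact Or.inl (by_contra fun h => Set.disjoint_left.1 hd hx ⟨subset_closure hxD, h⟩)
  · exact Or.inr hxD

theorem bounded_of_bounded_frontier (hD : IsClosed D)
    (hC : ∀ a b : ℝ, ∃ M : ℝ, ∀ p ∈ frontier D, (φ p).1 ∈ Set.Icc a b → |(φ p).2| ≤ M)
    {t : ℝ} (ht : IsCompact (D.domRestrict (fun p => (φ p).1) ⁻¹' {t})) (a b : ℝ) :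
    ∃ M : ℝ, ∀ p ∈ D, (φ p).1 ∈ Set.Icc a b → |(φ p).2| ≤ M := by
  -- The interval is enlarged to contain `t`, so that every half-strip over it meets the compact
  -- fibre's line.
  obtain ⟨M, hM⟩ := hC (min a t) (max b t)
  obtain ⟨N, hN⟩ := (ht.image (f := fun p : D => |(φ p).2|)
      ((continuous_snd.comp φ.continuous).comp continuous_subtype_val).abs).bddAbove
  have key : ∀ S : Set ℝ, Convex ℝ S → (∀ y ∈ S, M < |y|) → (∃ y ∈ S, N < |y|) →
      ∀ p ∈ D, (φ p).1 ∈ Set.Icc a b → (φ p).2 ∉ S := by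
    rintro S hS hMS ⟨y, hy, hyN⟩ p hp hab hpS
    have hpre : IsPreconnected (φ ⁻¹' (Set.Icc (min a t) (max b t) ×ˢ S)) :=
      φ.isPreconnected_preimage.2 ((convex_Icc _ _).isPreconnected.prod hS.isPreconnected)
    refine Set.disjoint_left.1 (disjoint_of_disjoint_frontier hpre hD ?_ ?_)
      (show p ∈ φ ⁻¹' _ from ⟨⟨(min_le_left _ _).trans hab.1, hab.2.trans (le_max_left _ _)⟩, hpS⟩) hp
    · exact Set.disjoint_left.2 fun q hq hqf => (hMS _ hq.2).not_ge (hM q hqf hq.1)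
    · refine ⟨φ.symm (t, y), ?_, fun hmem => hyN.not_ge (hN ⟨⟨_, hmem⟩, ?_, ?_⟩)⟩
      · rw [Set.mem_preimage, φ.apply_symm_apply]
        exact ⟨⟨min_le_right _ _, le_max_right _ _⟩, hy⟩
      · simp
      · simp
  -- The maximum with `0` separates the upper half-strip from the lower one.
  refine ⟨max M 0, fun p hp hab => not_lt.1 fun h => ?_⟩
  obtain ⟨h1, h2⟩ := max_lt_iff.1 h
  rcases lt_or_gt_of_ne (abs_pos.1 h2) with hneg | hpos
  · rw [abs_of_neg hneg] at h1
    refine key (Set.Iio (min (-M) 0)) (convex_Iio _) (fun y hy => ?_)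
      ⟨min (-M) 0 - |N| - 1, ?_, ?_⟩ p hp hab (lt_min (by linarith) hneg)
    · obtain ⟨h3, h4⟩ := lt_min_iff.1 (Set.mem_Iio.1 hy)
      rw [abs_of_neg h4]
      linarith
    · have := abs_nonneg N
      rw [Set.mem_Iio]
      linarith
    · rw [abs_of_neg (by linarith [abs_nonneg N, min_le_right (-M) 0])]
      linarith [le_abs_self N, min_le_right (-M) 0]
  · rw [abs_of_pos hpos] at h1
    refine key (Set.Ioi (max M 0)) (convex_Ioi _) (fun y hy => ?_)
      ⟨max M 0 + |N| + 1, ?_, ?_⟩ p hp hab (max_lt h1 hpos)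
    · obtain ⟨h3, h4⟩ := max_lt_iff.1 (Set.mem_Ioi.1 hy)
      rwa [abs_of_pos h4]
    · have := abs_nonneg N
      rw [Set.mem_Ioi]
      linarith
    · rw [abs_of_pos (by linarith [abs_nonneg N, le_max_right M 0])]
      linarith [le_abs_self N, le_max_right M 0]

theorem bounded_of_eventually_bounded {C : Set P}
    (hC : ∀ t : ℝ, ∃ M : ℝ, ∀ᶠ x in 𝓝 t, ∀ p ∈ C, (φ p).1 = x → |(φ p).2| ≤ M) (a b : ℝ) :
    ∃ M : ℝ, ∀ p ∈ C, (φ p).1 ∈ Set.Icc a b → |(φ p).2| ≤ M := by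
  refine isCompact_Icc.induction_on
    (p := fun S => ∃ M : ℝ, ∀ p ∈ C, (φ p).1 ∈ S → |(φ p).2| ≤ M) ⟨0, by simp⟩ ?_ ?_ ?_
  · rintro S T hST ⟨M, hM⟩
    exact ⟨M, fun p hp h => hM p hp (hST h)⟩
  · rintro S T ⟨M, hM⟩ ⟨N, hN⟩
    exact ⟨max M N, fun p hp h => h.elim (fun h => (hM p hp h).trans (le_max_left _ _))
      fun h => (hN p hp h).trans (le_max_right _ _)⟩
  · intro x _
    obtain ⟨M, hM⟩ := hC x
    exact ⟨_, mem_nhdsWithin_of_mem_nhds hM, M, fun p hp h => h p hp rfl⟩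

theorem eventually_bounded_sUnion {𝒦 : Set (Set P)} (hfin : 𝒦.Finite)
    (h : ∀ K ∈ 𝒦, ∀ t : ℝ, ∃ M : ℝ, ∀ᶠ x in 𝓝 t, ∀ p ∈ K, (φ p).1 = x → |(φ p).2| ≤ M) (t : ℝ) :
    ∃ M : ℝ, ∀ᶠ x in 𝓝 t, ∀ p ∈ ⋃₀ 𝒦, (φ p).1 = x → |(φ p).2| ≤ M := by
  choose! M hM using fun K hK => h K hK t
  obtain ⟨N, hN⟩ := (hfin.image M).bddAbove
  refine ⟨N, ?_⟩
  filter_upwards [(eventually_all_finite hfin).2 hM] with x hx p ⟨K, hK, hp⟩ hpx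
  exact (hx K hK p hp hpx).trans (hN ⟨K, hK, rfl⟩)

/-- The other components form a closed set missing `p`, so near `p` the union is a single component.
-/
theorem topCriticalSet_sUnion_subset {𝒦 : Set (Set P)} (hfin : 𝒦.Finite)
    (hdisj : 𝒦.PairwiseDisjoint id) (hclosed : ∀ K ∈ 𝒦, IsClosed K) (π : P → ℝ) :
    topCriticalSet π (⋃₀ 𝒦) ⊆ ⋃ K ∈ 𝒦, topCriticalSet π K := by
  rintro p ⟨⟨K, hK, hp⟩, hcrit⟩
  refine Set.mem_biUnion hK ⟨hp, fun ⟨U, hU, hpU, hemb⟩ => hcrit ?_⟩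
  have hO : IsClosed (⋃ K' ∈ 𝒦 \ {K}, K') :=
    hfin.sdiff.isClosed_biUnion fun K' hK' => hclosed K' hK'.1
  refine ⟨U ∩ (⋃ K' ∈ 𝒦 \ {K}, K')ᶜ, hU.inter hO.isOpen_compl, ⟨hpU, ?_⟩, ?_⟩
  · intro h
    obtain ⟨K', hK', hpK'⟩ := Set.mem_iUnion₂.1 h
    exact Set.disjoint_left.1 (hdisj hK'.1 hK hK'.2) hpK' hp
  · have hsub : U ∩ (⋃ K' ∈ 𝒦 \ {K}, K')ᶜ ∩ ⋃₀ 𝒦 ⊆ U ∩ K := by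
      rintro q ⟨⟨hqU, hq⟩, K', hK', hqK'⟩
      by_cases h : K' = K
      · exact ⟨hqU, h ▸ hqK'⟩
      · exact absurd (Set.mem_biUnion (show K' ∈ 𝒦 \ {K} from ⟨hK', h⟩) hqK') hq
    exact hemb.comp (IsEmbedding.inclusion hsub)

/-- The inclusion can be strict: at the vertical inflection of `y ^ 3 = x` the projection is still a
local homeomorphism. -/
theorem topCriticalSet_preimage_subset {G : ℝ[X][Y]} {z₀ : ℝ × ℝ} :
    topCriticalSet (fun p => (φ p).1) (φ ⁻¹' connectedComponentIn (zeroLocus G) z₀) ⊆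
      φ ⁻¹' {z ∈ connectedComponentIn (zeroLocus G) z₀ | (derivative G).evalEval z.1 z.2 = 0} := by
  rintro p ⟨hp, hcrit⟩
  refine ⟨hp, by_contra fun hy => hcrit ?_⟩
  obtain ⟨U, hU, hpU, hemb⟩ :=
    exists_isOpen_isEmbedding_fst G (connectedComponentIn_subset (zeroLocus G) z₀ hp) hy
  refine ⟨φ ⁻¹' U, hU.preimage φ.continuous, hpU, ?_⟩
  have hmem : ∀ q : ↥(φ ⁻¹' U ∩ φ ⁻¹' connectedComponentIn (zeroLocus G) z₀),
      φ q ∈ U ∩ zeroLocus G :=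
    fun q => ⟨q.2.1, connectedComponentIn_subset (zeroLocus G) z₀ q.2.2⟩
  exact hemb.comp ((φ.isEmbedding.comp IsEmbedding.subtypeVal).codRestrict _ hmem)

end Projection

/-! ### Boundary components in adapted coordinates -/

section Components

variable {V P : Type*} [AddCommGroup V] [Module ℝ V] [AddTorsor V P] [TopologicalSpace P]

theorem IsSmoothCurveComponent.exists_eq_preimage {K : Set P} (hK : IsSmoothCurveComponent K)
    (φ : P ≃ᵃ[ℝ] ℝ × ℝ) (Φ : P ≃ₜ ℝ × ℝ) (hΦ : ∀ p, Φ p = φ p) :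
    ∃ (G : ℝ[X][Y]) (z₀ : ℝ × ℝ), K = Φ ⁻¹' connectedComponentIn (zeroLocus G) z₀ ∧
      ∀ z ∈ connectedComponentIn (zeroLocus G) z₀,
        (derivative G).evalEval z.1 z.2 ≠ 0 ∨ (derivative (G.eval (C z.2))).eval z.1 ≠ 0 := by
  obtain ⟨e, F, ⟨p, hp, rfl⟩, hgrad⟩ := hK
  obtain ⟨G, hG, hsm⟩ := exists_evalEval_eq_eval (φ.symm.trans e) F
  have hLe : ∀ q, (φ.symm.trans e) (Φ q) = e q := fun q => by simp [hΦ]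
  have hset : Φ '' {q : P | MvPolynomial.eval (e q) F = 0} = zeroLocus G := by
    rw [Φ.image_eq_preimage_symm]
    ext z
    rw [← Φ.apply_symm_apply z, Set.mem_preimage, Φ.symm_apply_apply]
    change _ ↔ G.evalEval (Φ _).1 (Φ _).2 = 0
    rw [hG, hLe]
    rfl
  have hcc := Φ.image_connectedComponentIn (x := p) (s := {q : P | MvPolynomial.eval (e q) F = 0}) hp
  rw [hset] at hcc
  refine ⟨G, Φ p, ?_, fun z hz => ?_⟩
  · rw [← hcc, Φ.injective.preimage_image]
  · rw [← hcc] at hz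
    obtain ⟨q, hq, rfl⟩ := hz
    exact hsm _ (by simpa only [hLe] using hgrad q hq)

end Components

end AlgDomain

/-! ### The equivalence -/

open AlgDomain in
theorem mainTheorem9 {V P : Type*} [AddCommGroup V] [Module ℝ V] [TopologicalSpace V]
    [IsTopologicalAddGroup V] [ContinuousSMul ℝ V] [T2Space V]
    [AddTorsor V P] [TopologicalSpace P] [IsTopologicalAddTorsor P]
    (hV : Module.finrank ℝ V = 2)
    (π : P →ᵃ[ℝ] ℝ) (hπ : π.linear ≠ 0)
    (D : Set P) (hne : D.Nonempty) (hD : AlgDomain.IsAlgebraicDomain D) :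
    List.TFAE [
      AlgDomain.IsDomainOfFiniteType π D,
      IsProperMap (D.domRestrict π),
      (∃ t : ℝ, IsCompact (D.domRestrict π ⁻¹' {t})) ∧
        ¬ AlgDomain.ContainsVerticalLine π (frontier D) ∧
        ¬ AlgDomain.HasVerticalAsymptote π (frontier D)] := by
  obtain ⟨φ, hφ⟩ := exists_affineEquiv_fst_eq hV π hπ
  obtain ⟨hc, hc'⟩ := continuous_affineEquiv_prod hV φ
  let Φ : P ≃ₜ ℝ × ℝ := ⟨φ.toEquiv, hc, hc'⟩
  have hΦπ : (π : P → ℝ) = fun p => (Φ p).1 := funext fun p => (hφ p).symm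
  rw [hΦπ]
  obtain ⟨hclosed, hsurf, 𝒦, hfin, hdisj, hsm, hfr⟩ := hD
  choose! G z₀ hK hGsm using fun K hK => (hsm K hK).exists_eq_preimage φ Φ fun _ => rfl
  have hsub : frontier D ⊆ D := hclosed.frontier_subset
  have hline : ¬ ContainsVerticalLine (fun p => (Φ p).1) (frontier D) → ∀ K ∈ 𝒦,
      ¬ ContainsVerticalLine Prod.fst (connectedComponentIn (zeroLocus (G K)) (z₀ K)) := by
    rintro h K hK𝒦 ⟨t, ht⟩
    refine h ⟨t, fun p hp => hfr ▸ ⟨K, hK𝒦, ?_⟩⟩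
    rw [hK K hK𝒦]
    exact ht hp
  tfae_have 1 → 2 := fun h => h.isProper
  tfae_have 2 → 3 := by
    intro h
    have hb := (isProperMap_domRestrict_iff Φ hclosed).1 h
    have hbC : ∀ a b : ℝ, ∃ M : ℝ, ∀ p ∈ frontier D, (Φ p).1 ∈ Set.Icc a b → |(Φ p).2| ≤ M :=
      fun a b => (hb a b).imp fun M hM p hp => hM p (hsub hp)
    exact ⟨⟨0, h.isCompact_preimage isCompact_singleton⟩,
      not_containsVerticalLine_of_bounded Φ hbC, not_hasVerticalAsymptote_of_bounded Φ hbC⟩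
  tfae_have 3 → 2 := by
    rintro ⟨⟨t, ht⟩, hl, ha⟩
    rw [isProperMap_domRestrict_iff Φ hclosed]
    refine bounded_of_bounded_frontier Φ hclosed (bounded_of_eventually_bounded Φ ?_) ht
    rw [hfr]
    refine eventually_bounded_sUnion Φ hfin fun K hK𝒦 s => ?_
    obtain ⟨M, hM⟩ := eventually_abs_le_connectedComponentIn (hGsm K hK𝒦) (hline hl K hK𝒦) (by
      rintro ⟨u, γ, hγ, hi, hm, hinf, hu⟩
      refine ha ⟨u, Φ.symm ∘ γ, Φ.symm.continuous.comp hγ, Φ.symm.injective.comp hi,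
        fun s => hfr ▸ ⟨K, hK𝒦, ?_⟩, Φ.symm.isClosedEmbedding.tendsto_cocompact.comp hinf, ?_⟩
      · rw [hK K hK𝒦, Set.mem_preimage, Function.comp_apply, Φ.apply_symm_apply]
        exact hm s
      · simpa only [Function.comp_apply, Φ.apply_symm_apply] using hu) s
    refine ⟨M, hM.mono fun x h p hp hpx => h _ ?_⟩
    rw [hK K hK𝒦] at hp
    rw [← hpx]
    exact hp
  tfae_have 2 → 1 := by
    intro h
    obtain ⟨-, hl, -⟩ := tfae_2_to_3 h
    have hb := (isProperMap_domRestrict_iff Φ hclosed).1 h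
    refine ⟨hclosed, hsurf, ?_, h, ?_⟩
    -- In the connected plane a non-empty set has empty frontier only if it is the whole plane,
    -- which contains vertical lines and so is not bounded over intervals.
    · have : PreconnectedSpace P := 
        ⟨Φ.symm.surjective.range_eq ▸ isPreconnected_range Φ.symm.continuous⟩
      refine nonempty_frontier_iff.2 ⟨hne, ?_⟩
      rintro rfl
      exact not_containsVerticalLine_of_bounded Φ hb ⟨0, Set.subset_univ _⟩
    · rw [hfr]
      refine (hfin.biUnion fun K hK𝒦 => ?_).subset
        (topCriticalSet_sUnion_subset hfin hdisj (fun K hK𝒦 => ?_) _)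
      · rw [hK K hK𝒦]
        exact ((finite_derivative_eq_zero (hGsm K hK𝒦) (hline hl K hK𝒦)).preimage
          Φ.injective.injOn).subset (topCriticalSet_preimage_subset Φ)
      · rw [hK K hK𝒦]
        exact (isClosed_connectedComponentIn (isClosed_zeroLocus _) _).preimage Φ.continuous
  tfae_finish
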